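/- Let $\mathcal H$ be a separable complex Hilbert space and let $U$ be a unitary operator on $\mathcal H$. A spectral measure on the circle $\mathbb T$ assigns to each Borel set $\Omega\subseteq\mathbb T$ an orthogonal projection $E(\Omega)$ on $\mathcal H$, with $E(\emptyset)=0$, $E(\mathbb T)=I$, $E(\Omega_1\cap\Omega_2)=E(\Omega_1)E(\Omega_2)$, and $E(\bigcup_n\Omega_n)h=\sum_n E(\Omega_n)h$ for all $h\in\mathcal H$ and pairwise disjoint Borel sets $\Omega_n$. For $v\in\mathcal H$ let $\mathcal H(v)$ and $\mathcal H(v)_{\mathbb R}$ be the closed complex and the closed real linear span of $\{E(\Omega)v:\Omega\subseteq\mathbb T\text{ Borel}\}$. A cyclic decomposition for $E$ is a (finite or infinite, possibly empty) countable orthonormal family $(x_k)$ in $\mathcal H$ with $\mathcal H=\bigoplus_k\mathcal H(x_k)$ (orthogonal direct sum). (1) There is a spectral measure $E$ with $U=\int_{\mathbb T}\xi\,dE(\xi)$, that is, $\langle Uh,h\rangle=\int_{\mathbb T}\xi\,d\langle E(\xi)h,h\rangle$ for all $h\in\mathcal H$, and for every such $E$ there is a cyclic decomposition. (2) Let $E$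 be any spectral measure with $U=\int_{\mathbb T}\xi\,dE(\xi)$ and $(x_k)$ any cyclic decomposition for $E$. Put $\mathcal H_{\mathbb R}=\bigoplus_k\mathcal H(x_k)_{\mathbb R}$, the closed real linear span of all the vectors $E(\Omega)x_k$; the inner product of $\mathcal H$ is real-valued on it, and every $h\in\mathcal H$ is $h=h_r+ih_c$ with unique $h_r,h_c\in\mathcal H_{\mathbb R}$. Put $Q_{\mathbb R}(h_r+ih_c)=h_r$, and define bounded real-linear operators on $\mathcal H_{\mathbb R}$ by $U_ra=Q_{\mathbb R}(Ua)$ and $U_ca=-Q_{\mathbb R}(iUa)$. Let $\mathfrak C(\mathcal H_{\mathbb R})$ be the complex Hilbert space of pairs $(a,b)$ with $a,b\in\mathcal H_{\mathbb R}$, with componentwise addition, scalar multiplication $(s+it)(a,b)=(sa-tb,\,sb+ta)$, and inner product (linear in the first variable) $\langle(a,b),(c,d)\rangle=\langle a,c\rangle+\langle b,d\rangle+i(\langle b,c\rangle-\langle a,d\rangle)$. Then $U$ is unitarily equivalent to the bounded complex-linear operator $\widehat U=\begin{bmatrix}U_r&-U_c\\U_c&U_r\end{bmatrix}$ on $\mathfrak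 C(\mathcal H_{\mathbb R})$, $\widehat U(a,b)=(U_ra-U_cb,\,U_ca+U_rb)$: there is a surjective complex-linear isometry $V:\mathcal H\to\mathfrak C(\mathcal H_{\mathbb R})$ with $VU=\widehat UV$. -/

import Mathlib

open scoped InnerProductSpace

set_option linter.unusedSectionVars false

noncomputable section

/-- The unit circle carries its Borel sigma-algebra. -/
instance Circle.instMeasurableSpaceBorel : MeasurableSpace Circle := borel Circle

instance Circle.instBorelSpaceBorel : BorelSpace Circle := ⟨rfl⟩

/-- A (projection-valued) spectral measure on the Borel subsets of the unit circle, acting on `H`.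
The values on sets that are not Borel play no role. -/
structure SpectralMeasure (H : Type*) [NormedAddCommGroup H] [InnerProductSpace ℂ H]
    [CompleteSpace H] where
  /-- The projection attached to a set. -/
  proj : Set Circle → H →L[ℂ] H
  isStarProjection : ∀ Ω : Set Circle, MeasurableSet Ω → IsStarProjection (proj Ω)
  empty : proj ∅ = 0
  univ : proj Set.univ = 1
  inter : ∀ Ω₁ Ω₂ : Set Circle, MeasurableSet Ω₁ → MeasurableSet Ω₂ →
    proj (Ω₁ ∩ Ω₂) = proj Ω₁ * proj Ω₂
  iUnion : ∀ Ω : ℕ → Set Circle, (∀ n, MeasurableSet (Ω n)) →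
    Pairwise (Function.onFun Disjoint Ω) →
      ∀ h : H, HasSum (fun n => proj (Ω n) h) (proj (⋃ n, Ω n) h)

namespace SpectralMeasure

variable {H : Type*} [NormedAddCommGroup H] [InnerProductSpace ℂ H] [CompleteSpace H]

theorem re_inner_nonneg (E : SpectralMeasure H) (h : H) {Ω : Set Circle} (hΩ : MeasurableSet Ω) :
    0 ≤ (⟪h, E.proj Ω h⟫_ℂ).re := by
  have hp := E.isStarProjection Ω hΩ
  have h1 : E.proj Ω h = E.proj Ω (E.proj Ω h) :=
    (DFunLike.congr_fun hp.isIdempotentElem.eq h).symm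
  have h2 : ⟪h, E.proj Ω (E.proj Ω h)⟫_ℂ = ⟪E.proj Ω h, E.proj Ω h⟫_ℂ := by
    rw [← ContinuousLinearMap.adjoint_inner_left, ← ContinuousLinearMap.star_eq_adjoint,
      hp.isSelfAdjoint.star_eq]
  rw [h1, h2]
  exact inner_self_nonneg (𝕜 := ℂ)

/-- The finite positive Borel measure `Ω ↦ ⟨E(Ω) h, h⟩ = ‖E(Ω) h‖ ^ 2`. -/
def scalarMeasure (E : SpectralMeasure H) (h : H) : MeasureTheory.Measure Circle :=
  MeasureTheory.Measure.ofMeasurable (fun Ω _ => ENNReal.ofReal (⟪h, E.proj Ω h⟫_ℂ).re)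
    (by simp [E.empty])
    (by
      intro Ω hΩ hd
      have h1 : HasSum (fun n => (⟪h, E.proj (Ω n) h⟫_ℂ).re) (⟪h, E.proj (⋃ n, Ω n) h⟫_ℂ).re :=
        Complex.hasSum_re ((E.iUnion Ω hΩ hd h).mapL (innerSL ℂ h))
      rw [← h1.tsum_eq]
      exact ENNReal.ofReal_tsum_of_nonneg (fun n => E.re_inner_nonneg h (hΩ n)) h1.summable)

/-- `U = ∫ ξ dE(ξ)`: the quadratic forms of the two sides agree (which, by polarization, determines
a bounded operator on a complex Hilbert space). -/
def Represents (E : SpectralMeasure H) (U : H →L[ℂ] H) : Prop :=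
  ∀ h : H, ⟪h, U h⟫_ℂ = ∫ ξ : Circle, (ξ : ℂ) ∂(E.scalarMeasure h)

/-- The set of vectors `E(Ω) v`, with `Ω` a Borel subset of the circle. -/
def orbit (E : SpectralMeasure H) (v : H) : Set H :=
  {w | ∃ Ω : Set Circle, MeasurableSet Ω ∧ E.proj Ω v = w}

/-- `H(v)`: the closed complex linear span of the vectors `E(Ω) v`. -/
def cyclicSubspace (E : SpectralMeasure H) (v : H) : Submodule ℂ H :=
  (Submodule.span ℂ (E.orbit v)).topologicalClosure

/-- `H(v)_ℝ`: the closed real linear span of the vectors `E(Ω) v`. -/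
def realCyclicSubspace (E : SpectralMeasure H) (v : H) : Submodule ℝ H :=
  (Submodule.span ℝ (E.orbit v)).topologicalClosure

/-- `(x k)` is an orthonormal family such that `H` is the orthogonal direct sum (Hilbert sum) of
the subspaces `H(x k)`. -/
structure IsCyclicDecomposition (E : SpectralMeasure H) {ι : Type*} (x : ι → H) : Prop where
  orthonormal : Orthonormal ℂ x
  isHilbertSum : IsHilbertSum ℂ (fun k => E.cyclicSubspace (x k))
    (fun k => (E.cyclicSubspace (x k)).subtypeₗᵢ)

/-- `H_ℝ`: the orthogonal direct sum of the real subspaces `H(x k)_ℝ`, inside `H`. -/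
def realSubspace (E : SpectralMeasure H) {ι : Type*} (x : ι → H) : Submodule ℝ H :=
  (⨆ k, E.realCyclicSubspace (x k)).topologicalClosure

/-- `i H_ℝ`. -/
def imagSubspace (E : SpectralMeasure H) {ι : Type*} (x : ι → H) : Submodule ℝ H :=
  (E.realSubspace x).map (Complex.I • (LinearMap.id : H →ₗ[ℝ] H))

/-- `H_ℝ` is a real inner product space; its inner product is the restriction of that of `H`, which
is real-valued on `H_ℝ` when `x` is a cyclic decomposition (see `inner_im_eq_zero`). -/
instance instInnerProductSpaceRealSubspace (E : SpectralMeasure H) {ι : Type*} (x : ι → H) :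
    InnerProductSpace ℝ (E.realSubspace x) where
  inner a b := (⟪(a : H), (b : H)⟫_ℂ).re
  norm_sq_eq_re_inner a := norm_sq_eq_re_inner (𝕜 := ℂ) (a : H)
  conj_inner_symm a b := by
    simpa using inner_re_symm (𝕜 := ℂ) (b : H) (a : H)
  add_left a b c := by simp
  smul_left a b r := by
    have : ((r • a : E.realSubspace x) : H) = (r : ℂ) • (a : H) := by
      simp
    simp [this]

instance instCompleteSpaceRealSubspace (E : SpectralMeasure H) {ι : Type*} (x : ι → H) :
    CompleteSpace (E.realSubspace x) :=
  (Submodule.isClosed_topologicalClosure _).completeSpace_coe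

theorem im_inner_eq_zero_of_closure {S : Set H} (hS : ∀ a ∈ S, ∀ b ∈ S, (⟪a, b⟫_ℂ).im = 0) :
    ∀ a ∈ (Submodule.span ℝ S).topologicalClosure,
      ∀ b ∈ (Submodule.span ℝ S).topologicalClosure, (⟪a, b⟫_ℂ).im = 0 := by
  have key : ∀ T : Set H, ∀ a : H, (∀ b ∈ T, (⟪a, b⟫_ℂ).im = 0) →
      ∀ b ∈ (Submodule.span ℝ T).topologicalClosure, (⟪a, b⟫_ℂ).im = 0 := by
    intro T a hT b hb
    have h1 : ∀ b ∈ Submodule.span ℝ T, (⟪a, b⟫_ℂ).im = 0 := by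
      intro b hb
      induction hb using Submodule.span_induction with
      | mem b hb => exact hT b hb
      | zero => simp
      | add b c _ _ hb hc => simp [hb, hc]
      | smul r b _ hb =>
        rw [← Complex.coe_smul, inner_smul_right]
        simp [hb]
    have hcl : IsClosed {b : H | (⟪a, b⟫_ℂ).im = 0} :=
      isClosed_eq (by fun_prop) continuous_const
    exact closure_minimal (s := (Submodule.span ℝ T : Set H)) h1 hcl hb
  have symm : ∀ a b : H, (⟪a, b⟫_ℂ).im = 0 → (⟪b, a⟫_ℂ).im = 0 := by
    intro a b h
    rw [← inner_conj_symm, Complex.conj_im, h, neg_zero]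
  intro a ha b hb
  refine key S a (fun c hc => symm c a (key S c (fun d hd => hS c hc d hd) a ha)) b hb

theorem im_inner_orbit (E : SpectralMeasure H) (v : H) :
    ∀ a ∈ E.orbit v, ∀ b ∈ E.orbit v, (⟪a, b⟫_ℂ).im = 0 := by
  rintro _ ⟨Ω₁, h₁, rfl⟩ _ ⟨Ω₂, h₂, rfl⟩
  have hp := E.isStarProjection _ (h₁.inter h₂)
  have e1 : ⟪E.proj Ω₁ v, E.proj Ω₂ v⟫_ℂ = ⟪v, E.proj (Ω₁ ∩ Ω₂) v⟫_ℂ := by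
    rw [E.inter _ _ h₁ h₂, mul_apply_eq_comp,
      ← ContinuousLinearMap.adjoint_inner_left (E.proj Ω₁), ← ContinuousLinearMap.star_eq_adjoint,
      (E.isStarProjection _ h₁).isSelfAdjoint.star_eq]
  rw [e1, ← Complex.conj_eq_iff_im, inner_conj_symm, ← ContinuousLinearMap.adjoint_inner_right,
    ← ContinuousLinearMap.star_eq_adjoint, hp.isSelfAdjoint.star_eq]

theorem realCyclicSubspace_le (E : SpectralMeasure H) (v : H) :
    (E.realCyclicSubspace v : Set H) ⊆ E.cyclicSubspace v :=
  closure_mono (Submodule.span_le_restrictScalars ℝ ℂ (E.orbit v))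

variable {E : SpectralMeasure H} {ι : Type*} {x : ι → H}

/-- The inner product of `H` is real-valued on `H_ℝ`. -/
theorem inner_im_eq_zero (hx : E.IsCyclicDecomposition x) {a b : H}
    (ha : a ∈ E.realSubspace x) (hb : b ∈ E.realSubspace x) : (⟪a, b⟫_ℂ).im = 0 := by
  unfold realSubspace at ha hb
  rw [Submodule.iSup_eq_span] at ha hb
  refine im_inner_eq_zero_of_closure ?_ a ha b hb
  intro a ha b hb
  obtain ⟨j, hj⟩ := Set.mem_iUnion.1 ha
  obtain ⟨k, hk⟩ := Set.mem_iUnion.1 hb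
  by_cases hjk : j = k
  · subst hjk
    exact im_inner_eq_zero_of_closure (E.im_inner_orbit (x j)) a hj b hk
  · have := hx.isHilbertSum.OrthogonalFamily hjk ⟨a, E.realCyclicSubspace_le _ hj⟩
      ⟨b, E.realCyclicSubspace_le _ hk⟩
    simp only [Submodule.coe_subtypeₗᵢ, Submodule.subtype_apply] at this
    simp [this]

end SpectralMeasure

/-- The complexification of a real inner product space `K`: pairs of vectors of `K`, with norm
`‖(a, b)‖ ^ 2 = ‖a‖ ^ 2 + ‖b‖ ^ 2`, with `(s + i t) (a, b) = (s a - t b, s b + t a)`, and with the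
complex inner product below. -/
def Complexification (K : Type*) : Type _ := WithLp 2 (K × K)

namespace Complexification

variable {K : Type*} [NormedAddCommGroup K] [InnerProductSpace ℝ K]

instance : NormedAddCommGroup (Complexification K) :=
  inferInstanceAs (NormedAddCommGroup (WithLp 2 (K × K)))

instance [CompleteSpace K] : CompleteSpace (Complexification K) :=
  inferInstanceAs (CompleteSpace (WithLp 2 (K × K)))

/-- The pair `(a, b)`. -/
def mk (a b : K) : Complexification K := WithLp.toLp 2 (a, b)

/-- The first component. -/
def fst (z : Complexification K) : K := (WithLp.ofLp z).1

/-- The second component. -/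
def snd (z : Complexification K) : K := (WithLp.ofLp z).2

@[simp] theorem fst_mk (a b : K) : (mk a b).fst = a := rfl
@[simp] theorem snd_mk (a b : K) : (mk a b).snd = b := rfl
@[simp] theorem fst_add (z w : Complexification K) : (z + w).fst = z.fst + w.fst := rfl
@[simp] theorem snd_add (z w : Complexification K) : (z + w).snd = z.snd + w.snd := rfl
@[simp] theorem fst_zero : (0 : Complexification K).fst = 0 := rfl
@[simp] theorem snd_zero : (0 : Complexification K).snd = 0 := rfl

theorem ext {z w : Complexification K} (h₁ : z.fst = w.fst) (h₂ : z.snd = w.snd) : z = w :=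
  (WithLp.ofLp_injective 2) (Prod.ext h₁ h₂)

theorem norm_sq (z : Complexification K) : ‖z‖ ^ 2 = ‖z.fst‖ ^ 2 + ‖z.snd‖ ^ 2 :=
  WithLp.prod_norm_sq_eq_of_L2 (α := K) (β := K) z

theorem continuous_fst : Continuous (fst : Complexification K → K) :=
  _root_.continuous_fst.comp (WithLp.prod_continuous_ofLp 2 K K)

theorem continuous_snd : Continuous (snd : Complexification K → K) :=
  _root_.continuous_snd.comp (WithLp.prod_continuous_ofLp 2 K K)

theorem continuous_mk {X : Type*} [TopologicalSpace X] {f g : X → K} (hf : Continuous f)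
    (hg : Continuous g) : Continuous (fun t => mk (f t) (g t)) :=
  (WithLp.prod_continuous_toLp 2 K K).comp (hf.prodMk hg)

instance : SMul ℂ (Complexification K) where
  smul c z := mk (c.re • z.fst - c.im • z.snd) (c.re • z.snd + c.im • z.fst)

@[simp] theorem fst_smul (c : ℂ) (z : Complexification K) :
    (c • z).fst = c.re • z.fst - c.im • z.snd := rfl
@[simp] theorem snd_smul (c : ℂ) (z : Complexification K) :
    (c • z).snd = c.re • z.snd + c.im • z.fst := rfl

instance : Module ℂ (Complexification K) where
  one_smul z := by apply ext <;> simp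
  mul_smul c d z := by apply ext <;> simp <;> module
  smul_zero c := by apply ext <;> simp
  smul_add c z w := by apply ext <;> simp <;> module
  add_smul c d z := by apply ext <;> simp <;> module
  zero_smul z := by apply ext <;> simp

instance : NormedSpace ℂ (Complexification K) where
  norm_smul_le c z := by
    refine le_of_eq ((sq_eq_sq₀ (norm_nonneg _) (by positivity)).1 ?_)
    rw [mul_pow, norm_sq, norm_sq, fst_smul, snd_smul, norm_sub_sq_real, norm_add_sq_real,
      Complex.sq_norm, Complex.normSq_apply]
    simp only [norm_smul, real_inner_smul_left, real_inner_smul_right, mul_pow, Real.norm_eq_abs,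
      sq_abs, real_inner_comm z.fst z.snd]
    ring

/-- The inner product is, in Mathlib's convention, conjugate-linear in the first variable. -/
instance : InnerProductSpace ℂ (Complexification K) where
  inner z w := ⟨⟪z.fst, w.fst⟫_ℝ + ⟪z.snd, w.snd⟫_ℝ, ⟪z.fst, w.snd⟫_ℝ - ⟪z.snd, w.fst⟫_ℝ⟩
  norm_sq_eq_re_inner z := by
    simp [norm_sq]
  conj_inner_symm z w := by
    apply Complex.ext <;> simp [real_inner_comm]
  add_left z w u := by
    apply Complex.ext <;> simp [inner_add_left] <;> ring
  smul_left z w c := by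
    apply Complex.ext <;>
      simp [inner_add_left, inner_sub_left, real_inner_smul_left] <;> ring

/-- The operator with block matrix `[[A, -B], [B, A]]` on the complexification. -/
def blockOp (A B : K →L[ℝ] K) : Complexification K →L[ℂ] Complexification K where
  toFun z := mk (A z.fst - B z.snd) (B z.fst + A z.snd)
  map_add' z w := by apply ext <;> simp <;> abel
  map_smul' c z := by apply ext <;> simp <;> module
  cont := continuous_mk
    ((A.continuous.comp continuous_fst).sub (B.continuous.comp continuous_snd))
    ((B.continuous.comp continuous_fst).add (A.continuous.comp continuous_snd))

end Complexification

namespace SpectralMeasure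

variable {H : Type*} [NormedAddCommGroup H] [InnerProductSpace ℂ H] [CompleteSpace H]
  {E : SpectralMeasure H} {ι : Type*} {x : ι → H}

theorem mem_imagSubspace {h : H} :
    h ∈ E.imagSubspace x ↔ ∃ a ∈ E.realSubspace x, Complex.I • a = h := by
  simp [imagSubspace]

theorem isClosed_realSubspace : IsClosed (E.realSubspace x : Set H) :=
  Submodule.isClosed_topologicalClosure _

theorem isClosed_imagSubspace : IsClosed (E.imagSubspace x : Set H) := by
  have : (E.imagSubspace x : Set H) = (fun h => (-Complex.I) • h) ⁻¹' (E.realSubspace x) := by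
    ext h
    simp only [SetLike.mem_coe, mem_imagSubspace, Set.mem_preimage]
    constructor
    · rintro ⟨a, ha, rfl⟩
      simpa [smul_smul] using ha
    · intro hh
      exact ⟨_, hh, by simp [smul_smul]⟩
  rw [this]
  exact isClosed_realSubspace.preimage (by fun_prop)

theorem norm_add_I_smul (hx : E.IsCyclicDecomposition x) {a b : H}
    (ha : a ∈ E.realSubspace x) (hb : b ∈ E.realSubspace x) :
    ‖a + Complex.I • b‖ ^ 2 = ‖a‖ ^ 2 + ‖b‖ ^ 2 := by
  have h := norm_add_sq (𝕜 := ℂ) a (Complex.I • b)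
  have h0 : (⟪a, Complex.I • b⟫_ℂ).re = 0 := by
    simp [inner_im_eq_zero hx ha hb]
  rw [h]
  simp [norm_smul, h0]

/-- Every vector of `H` is `a + i b` for a unique pair of vectors `a`, `b` of `H_ℝ`. -/
theorem isCompl_real_imag (hx : E.IsCyclicDecomposition x) :
    IsCompl (E.realSubspace x) (E.imagSubspace x) := by
  constructor
  · rw [Submodule.disjoint_def]
    intro a ha ha'
    obtain ⟨b, hb, rfl⟩ := mem_imagSubspace.1 ha'
    have h := norm_add_I_smul hx ha (neg_mem hb)
    simp only [norm_smul, Complex.norm_I, norm_neg, smul_neg, add_neg_cancel, norm_zero,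
      one_mul] at h
    have hb0 : ‖b‖ = 0 := by nlinarith [norm_nonneg b]
    rw [norm_eq_zero.1 hb0, smul_zero]
  · let T : Complexification (E.realSubspace x) →ₗ[ℂ] H :=
      { toFun := fun z => (z.fst : H) + Complex.I • (z.snd : H)
        map_add' := fun z w => by
          simp only [Complexification.fst_add, Complexification.snd_add, Submodule.coe_add]
          module
        map_smul' := fun c z => by
          simp only [Complexification.fst_smul, Complexification.snd_smul, Submodule.coe_add,
            Submodule.coe_sub, Submodule.coe_smul, RingHom.id_apply, ← Complex.coe_smul]
          conv_rhs => rw [← Complex.re_add_im c]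
          (match_scalars <;> ring_nf); simp }
    have hT : Isometry T := AddMonoidHomClass.isometry_of_norm T fun z => by
      refine (sq_eq_sq₀ (norm_nonneg _) (norm_nonneg _)).1 ?_
      rw [Complexification.norm_sq]
      exact norm_add_I_smul hx z.fst.2 z.snd.2
    have hcl : IsClosed (LinearMap.range T : Set H) := by
      rw [LinearMap.coe_range]
      exact hT.isClosedEmbedding.isClosed_range
    have hsub : ∀ k, E.cyclicSubspace (x k) ≤ LinearMap.range T := by
      intro k
      refine Submodule.topologicalClosure_minimal _ (Submodule.span_le.2 fun a ha => ?_) hcl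
      have h1 : a ∈ E.realCyclicSubspace (x k) :=
        Submodule.le_topologicalClosure _ (Submodule.subset_span ha)
      have h2 : a ∈ E.realSubspace x :=
        Submodule.le_topologicalClosure _ (Submodule.mem_iSup_of_mem k h1)
      exact ⟨Complexification.mk ⟨a, h2⟩ 0, by simp [T]⟩
    have htop : ∀ h : H, h ∈ LinearMap.range T := by
      intro h
      obtain ⟨f, rfl⟩ := hx.isHilbertSum.surjective_isometry h
      refine hcl.mem_of_tendsto (hx.isHilbertSum.OrthogonalFamily.hasSum_linearIsometry f)
        (Filter.Eventually.of_forall fun s => ?_)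
      exact Submodule.sum_mem _ fun k _ => hsub k (f k).2
    rw [codisjoint_iff, eq_top_iff]
    intro h _
    obtain ⟨z, rfl⟩ := htop h
    exact Submodule.add_mem_sup z.fst.2 (mem_imagSubspace.2 ⟨_, z.snd.2, rfl⟩)

theorem isTopCompl_real_imag (hx : E.IsCyclicDecomposition x) :
    Submodule.IsTopCompl (E.realSubspace x) (E.imagSubspace x) :=
  Submodule.IsCompl.isTopCompl_of_isClosed (isCompl_real_imag hx) isClosed_realSubspace isClosed_imagSubspace

/-- `Q_ℝ`: the real-linear map of `H` onto `H_ℝ` with `Q_ℝ (a + i b) = a` for `a`, `b` in `H_ℝ`. -/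
def realPart (hx : E.IsCyclicDecomposition x) : H →L[ℝ] E.realSubspace x :=
  Submodule.projectionOntoL _ _ (isTopCompl_real_imag hx)

theorem realPart_add_I_smul (hx : E.IsCyclicDecomposition x) (a b : E.realSubspace x) :
    realPart hx ((a : H) + Complex.I • (b : H)) = a := by
  have hb : Complex.I • (b : H) ∈ E.imagSubspace x := mem_imagSubspace.2 ⟨b, b.2, rfl⟩
  have h1 := Submodule.projectionOntoL_apply_left (isTopCompl_real_imag hx) a
  have h2 := Submodule.projectionOntoL_apply_right (isTopCompl_real_imag hx) ⟨_, hb⟩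
  rw [realPart, map_add, h1, h2, add_zero]

/-- `U_r a = Q_ℝ (U a)`, a real-linear operator on `H_ℝ`. -/
def realComponent (hx : E.IsCyclicDecomposition x) (U : H →L[ℂ] H) :
    E.realSubspace x →L[ℝ] E.realSubspace x :=
  realPart hx ∘L U.restrictScalars ℝ ∘L (E.realSubspace x).subtypeL

/-- `U_c a = -Q_ℝ (i U a)`, a real-linear operator on `H_ℝ`. -/
def imagComponent (hx : E.IsCyclicDecomposition x) (U : H →L[ℂ] H) :
    E.realSubspace x →L[ℝ] E.realSubspace x :=
  -(realPart hx ∘L (Complex.I • U).restrictScalars ℝ ∘L (E.realSubspace x).subtypeL)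

end SpectralMeasure

/-- Unitary equivalence of bounded operators on two complex Hilbert spaces. -/
def UnitarilyEquivalent {H₁ H₂ : Type*} [NormedAddCommGroup H₁] [InnerProductSpace ℂ H₁]
    [NormedAddCommGroup H₂] [InnerProductSpace ℂ H₂] (A : H₁ →L[ℂ] H₁) (B : H₂ →L[ℂ] H₂) : Prop :=
  ∃ V : H₁ ≃ₗᵢ[ℂ] H₂, ∀ h : H₁, V (A h) = B (V h)

end

/-! Spectral measure: pull the continuous functional calculus of `U` back to a star homomorphism `Φ`
on `C(Circle, ℂ)`. For each `h` the functional `f ↦ ⟪h, Φ f h⟫` is positive, so by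
Riesz–Markov–Kakutani it is integration against a finite measure `μ h`, and `f ↦ Φ f h` extends to
an isometry `S h` of `L²(μ h)` into `H`. The projection of `Ω` sends `h` to the image under `S h` of
the indicator of `Ω`. Linearity in `h` is the delicate point (`exists_proj`), since the `L²` space
varies with `h`. The other axioms reduce to computations with indicators in one `L²(μ h)`, together
with polarization.

Cyclic decomposition: take a maximal set of unit vectors with mutually orthogonal orbits. A nonzero
vector orthogonal to all their cyclic subspaces could be normalized and added to the set.
Separability makes the set countable.

Block form: the inner product is real on `H_ℝ`, so `(a, b) ↦ a + i b` is a unitary from the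
complexification of `H_ℝ` onto `H`. On `H_ℝ` one has `U a = U_r a + i U_c a`, and complex linearity
of `U` then gives the block matrix. -/

open MeasureTheory

/-! ### Continuous functional calculus and the measures of its vector states -/

section FunctionalCalculus

variable {H : Type*} [NormedAddCommGroup H] [InnerProductSpace ℂ H] [CompleteSpace H]

/-- The continuous functional calculus of a unitary operator, on continuous functions on the
circle. -/
theorem exists_starAlgHom_of_unitary (U : H →L[ℂ] H) (hU : U ∈ unitary (H →L[ℂ] H)) :
    ∃ Φ : C(Circle, ℂ) →⋆ₐ[ℂ] (H →L[ℂ] H), Φ ⟨fun ξ => (ξ : ℂ), by fun_prop⟩ = U := by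
  have hn : IsStarNormal U := by
    rw [Unitary.mem_iff] at hU
    exact ⟨hU.1.trans hU.2.symm⟩
  -- The spectrum of a unitary lies in the circle, so functions on the circle restrict to it along
  -- `j`.
  let j : C(spectrum ℂ U, Circle) :=
    ⟨fun z => ⟨z, by simpa [Submonoid.unitSphere] using spectrum.subset_circle_of_unitary hU z.2⟩,
      by fun_prop⟩
  refine ⟨(cfcHom (R := ℂ) hn).comp (ContinuousMap.compStarAlgHom' ℂ ℂ j), ?_⟩
  conv_rhs => rw [← cfcHom_id (R := ℂ) hn]
  rfl

theorem inner_starAlgHom_apply_apply (Φ : C(Circle, ℂ) →⋆ₐ[ℂ] (H →L[ℂ] H)) (f g : C(Circle, ℂ))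
    (h : H) : ⟪Φ f h, Φ g h⟫_ℂ = ⟪h, Φ (star f * g) h⟫_ℂ := by
  rw [map_mul, map_star, mul_apply_eq_comp, ContinuousLinearMap.star_eq_adjoint,
    ContinuousLinearMap.adjoint_inner_right]

/-- The inclusion of the real-valued continuous functions into the complex-valued ones. -/
noncomputable def ofRealContinuousMap (f : C(Circle, ℝ)) : C(Circle, ℂ) :=
  ⟨fun ξ => (f ξ : ℂ), by fun_prop⟩

/-- A real function is self-adjoint in `C(Circle, ℂ)`, so its image under `Φ` has a real quadratic
form. -/
theorem im_inner_ofRealContinuousMap (Φ : C(Circle, ℂ) →⋆ₐ[ℂ] (H →L[ℂ] H)) (f : C(Circle, ℝ))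
    (h : H) : (⟪h, Φ (ofRealContinuousMap f) h⟫_ℂ).im = 0 := by
  have hs : star (ofRealContinuousMap f) = ofRealContinuousMap f := by
    ext ξ; simp [ofRealContinuousMap]
  have h1 := inner_starAlgHom_apply_apply Φ (ofRealContinuousMap f) 1 h
  rw [hs, mul_one, map_one, one_apply_eq_self] at h1
  rw [← Complex.conj_eq_iff_im, inner_conj_symm, h1]

/-- With `g = √f` the form equals `‖Φ g h‖²`. This is the positivity that Riesz–Markov–Kakutani
requires. -/
theorem re_inner_ofRealContinuousMap_nonneg (Φ : C(Circle, ℂ) →⋆ₐ[ℂ] (H →L[ℂ] H))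
    {f : C(Circle, ℝ)} (hf : ∀ ξ, 0 ≤ f ξ) (h : H) :
    0 ≤ (⟪h, Φ (ofRealContinuousMap f) h⟫_ℂ).re := by
  let g : C(Circle, ℂ) := ofRealContinuousMap ⟨fun ξ => √(f ξ), by fun_prop⟩
  have hg : ofRealContinuousMap f = star g * g := by
    ext ξ
    simp only [ofRealContinuousMap, ContinuousMap.coe_mk, ContinuousMap.mul_apply,
      ContinuousMap.star_apply, g, RCLike.star_def, Complex.conj_ofReal]
    rw [← Complex.ofReal_mul, Real.mul_self_sqrt (hf ξ)]
  rw [hg, ← inner_starAlgHom_apply_apply]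
  exact inner_self_nonneg (𝕜 := ℂ)

/-- The measure representing the vector state `f ↦ ⟨h, Φ f h⟩`. -/
theorem exists_measure_inner_eq_integral (Φ : C(Circle, ℂ) →⋆ₐ[ℂ] (H →L[ℂ] H)) (h : H) :
    ∃ μ : Measure Circle, IsFiniteMeasure μ ∧
      ∀ f : C(Circle, ℂ), ⟪h, Φ f h⟫_ℂ = ∫ ξ, f ξ ∂μ := by
  let Λ : CompactlySupportedContinuousMap Circle ℝ →ₚ[ℝ] ℝ := PositiveLinearMap.mk₀
    { toFun := fun f => (⟪h, Φ (ofRealContinuousMap f.toContinuousMap) h⟫_ℂ).re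
      map_add' := fun f g => by
        have : ofRealContinuousMap (f + g).toContinuousMap =
          ofRealContinuousMap f.toContinuousMap + ofRealContinuousMap g.toContinuousMap := by
          ext ξ; simp [ofRealContinuousMap]
        rw [this, map_add, add_apply, inner_add_right, Complex.add_re]
      map_smul' := fun c f => by
        have : ofRealContinuousMap (c • f).toContinuousMap =
          (c : ℂ) • ofRealContinuousMap f.toContinuousMap := by
          ext ξ; simp [ofRealContinuousMap]
        rw [this, map_smul, smul_apply, inner_smul_right]
        simp }
    (fun f hf => re_inner_ofRealContinuousMap_nonneg Φ hf h)
  have hfin : IsFiniteMeasure (RealRMK.rieszMeasure Λ) := inferInstance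
  refine ⟨RealRMK.rieszMeasure Λ, hfin, fun f => ?_⟩
  have hreal : ∀ g : C(Circle, ℝ), ⟪h, Φ (ofRealContinuousMap g) h⟫_ℂ =
      ∫ ξ, (g ξ : ℂ) ∂(RealRMK.rieszMeasure Λ) := by
    intro g
    have h1 := RealRMK.integral_rieszMeasure Λ
      (⟨g, HasCompactSupport.of_compactSpace _⟩ : CompactlySupportedContinuousMap Circle ℝ)
    rw [integral_complex_ofReal]
    refine Complex.ext ?_ ?_
    · exact h1.symm
    · rw [im_inner_ofRealContinuousMap, Complex.ofReal_im]
  let u : C(Circle, ℝ) := ⟨fun ξ => (f ξ).re, by fun_prop⟩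
  let v : C(Circle, ℝ) := ⟨fun ξ => (f ξ).im, by fun_prop⟩
  have hf : f = ofRealContinuousMap u + Complex.I • ofRealContinuousMap v := by
    ext ξ
    simp [ofRealContinuousMap, u, v, mul_comm Complex.I, Complex.re_add_im]
  have hint : ∀ g : C(Circle, ℝ), Integrable (fun ξ => (g ξ : ℂ)) (RealRMK.rieszMeasure Λ) :=
    fun g => Continuous.integrable_of_hasCompactSupport (by fun_prop)
      (HasCompactSupport.of_compactSpace _)
  conv_lhs => rw [hf, map_add, map_smul, add_apply,
    smul_apply, inner_add_right, inner_smul_right, hreal, hreal,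
    ← integral_const_mul, ← integral_add (hint u) ((hint v).const_mul _)]
  congr 1 with ξ
  simp [u, v, mul_comm Complex.I, Complex.re_add_im]

/-- The isometry of `L²(μ)` into `H` extending `f ↦ Φ f h`. -/
theorem exists_linearIsometry_toLp (Φ : C(Circle, ℂ) →⋆ₐ[ℂ] (H →L[ℂ] H)) (h : H)
    (μ : Measure Circle) [IsFiniteMeasure μ]
    (hμ : ∀ f : C(Circle, ℂ), ⟪h, Φ f h⟫_ℂ = ∫ ξ, f ξ ∂μ) :
    ∃ S : Lp ℂ 2 μ →ₗᵢ[ℂ] H, ∀ f : C(Circle, ℂ), S (ContinuousMap.toLp 2 μ ℂ f) = Φ f h := by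
  let T : C(Circle, ℂ) →ₗ[ℂ] H :=
    { toFun := fun f => Φ f h
      map_add' := fun f g => by simp
      map_smul' := fun c f => by simp }
  -- `‖Φ f h‖² = ⟪h, Φ (f̄ f) h⟫ = ∫ |f|² dμ`, so `Φ f h` depends only on the `L²` class of `f` and
  -- extends from the dense image of the continuous functions.
  have hT : ∀ f, ‖T f‖ = ‖(ContinuousMap.toLp 2 μ ℂ : C(Circle, ℂ) →L[ℂ] Lp ℂ 2 μ) f‖ := by
    intro f
    have h1 : ⟪T f, T f⟫_ℂ = ⟪ContinuousMap.toLp 2 μ ℂ f, ContinuousMap.toLp 2 μ ℂ f⟫_ℂ := by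
      rw [ContinuousMap.inner_toLp]
      change ⟪Φ f h, Φ f h⟫_ℂ = _
      rw [inner_starAlgHom_apply_apply, hμ]
      congr 1 with ξ
      simp [mul_comm]
    rw [inner_self_eq_norm_sq_to_K, inner_self_eq_norm_sq_to_K] at h1
    exact (sq_eq_sq₀ (norm_nonneg _) (norm_nonneg _)).1 (by exact_mod_cast h1)
  have hd : DenseRange (ContinuousMap.toLp 2 μ ℂ : C(Circle, ℂ) →L[ℂ] Lp ℂ 2 μ) :=
    ContinuousMap.toLp_denseRange ℂ μ ℂ (by simp)
  let S := T.extendOfNorm (ContinuousMap.toLp 2 μ ℂ : C(Circle, ℂ) →L[ℂ] Lp ℂ 2 μ).toLinearMap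
  have hS : ∀ f, S (ContinuousMap.toLp 2 μ ℂ f) = T f := fun f =>
    LinearMap.extendOfNorm_eq hd ⟨1, fun f => by rw [one_mul]; exact (hT f).le⟩ f
  refine ⟨⟨S.toLinearMap, fun a => ?_⟩, hS⟩
  refine hd.induction (P := fun a => ‖S a‖ = ‖a‖) ?_ (isClosed_eq (by fun_prop) (by fun_prop)) a
  rintro _ ⟨f, rfl⟩
  rw [hS, hT]

end FunctionalCalculus

/-! ### Approximation of indicators in `L²` -/

/-- Indicator functions are approximable by continuous functions, simultaneously in the `L²` spaces
of all measures dominated by a given finite measure. -/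
theorem exists_continuousMap_norm_indicatorConstLp_sub_le (ν : Measure Circle) [IsFiniteMeasure ν]
    {Ω : Set Circle} (hΩ : MeasurableSet Ω) {ε : ℝ} (hε : 0 < ε) :
    ∃ g : C(Circle, ℂ), ∀ (μ : Measure Circle) [IsFiniteMeasure μ], μ ≤ ν →
      ‖indicatorConstLp 2 hΩ (measure_ne_top μ Ω) (1 : ℂ) - ContinuousMap.toLp 2 μ ℂ g‖ ≤ ε := by
  -- `g` is chosen for `ν` alone; the seminorm is monotone in the measure, so the same `g` serves
  -- every `μ ≤ ν`.
  obtain ⟨g, hg, -⟩ := (memLp_indicator_const 2 hΩ (1 : ℂ)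
    (Or.inr (measure_ne_top ν Ω))).exists_boundedContinuous_eLpNorm_sub_le (by simp)
    (ENNReal.ofReal_pos.2 hε).ne'
  refine ⟨g.toContinuousMap, fun μ _ hμ => ?_⟩
  have hc : (ContinuousMap.toLp 2 μ ℂ g.toContinuousMap : Circle → ℂ) =ᵐ[μ] g :=
    ContinuousMap.coeFn_toLp μ g.toContinuousMap
  have hi := indicatorConstLp_coeFn (p := 2) (hs := hΩ) (hμs := measure_ne_top μ Ω) (c := (1 : ℂ))
  rw [Lp.norm_def, eLpNorm_congr_ae ((Lp.coeFn_sub _ _).trans (hi.sub hc))]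
  exact ENNReal.toReal_le_of_le_ofReal hε.le ((eLpNorm_mono_measure _ hμ).trans hg)

/-! ### Construction of the spectral measure -/

section SpectralTheorem

variable {H : Type*} [NormedAddCommGroup H] [InnerProductSpace ℂ H] [CompleteSpace H]

/-- Expand the square: distinct pieces are orthogonal, and each piece pairs with the union to give
its own measure, so the cross terms and the diagonal combine to a single negative sum. -/
theorem norm_indicatorConstLp_sub_sum_sq (μ : Measure Circle) [IsFiniteMeasure μ]
    {Ω : ℕ → Set Circle} (hΩ : ∀ n, MeasurableSet (Ω n))
    (hd : Pairwise (Function.onFun Disjoint Ω)) (s : Finset ℕ) :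
    ‖indicatorConstLp 2 (MeasurableSet.iUnion hΩ) (measure_ne_top μ _) (1 : ℂ) -
      ∑ n ∈ s, indicatorConstLp 2 (hΩ n) (measure_ne_top μ _) (1 : ℂ)‖ ^ 2 =
      μ.real (⋃ n, Ω n) - ∑ n ∈ s, μ.real (Ω n) := by
  have h1 : ∀ n, ⟪indicatorConstLp 2 (MeasurableSet.iUnion hΩ) (measure_ne_top μ _) (1 : ℂ),
      indicatorConstLp 2 (hΩ n) (measure_ne_top μ _) (1 : ℂ)⟫_ℂ = (μ.real (Ω n) : ℂ) := by
    intro n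
    rw [L2.inner_indicatorConstLp_one_indicatorConstLp_one,
      Set.inter_eq_self_of_subset_right (Set.subset_iUnion Ω n)]
    rfl
  have h2 : ∀ m n, ⟪indicatorConstLp 2 (hΩ m) (measure_ne_top μ _) (1 : ℂ),
      indicatorConstLp 2 (hΩ n) (measure_ne_top μ _) (1 : ℂ)⟫_ℂ =
        if m = n then (μ.real (Ω n) : ℂ) else 0 := by
    intro m n
    rw [L2.inner_indicatorConstLp_one_indicatorConstLp_one]
    split_ifs with h
    · rw [h, Set.inter_self]; rfl
    · rw [(hd h).inter_eq]; simp
  have h3 : ⟪indicatorConstLp 2 (MeasurableSet.iUnion hΩ) (measure_ne_top μ _) (1 : ℂ),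
      indicatorConstLp 2 (MeasurableSet.iUnion hΩ) (measure_ne_top μ _) (1 : ℂ)⟫_ℂ =
        (μ.real (⋃ n, Ω n) : ℂ) := by
    rw [L2.inner_indicatorConstLp_one_indicatorConstLp_one, Set.inter_self]; rfl
  have h4 : ∀ n, ⟪indicatorConstLp 2 (hΩ n) (measure_ne_top μ _) (1 : ℂ),
      indicatorConstLp 2 (MeasurableSet.iUnion hΩ) (measure_ne_top μ _) (1 : ℂ)⟫_ℂ =
        (μ.real (Ω n) : ℂ) := fun n => by
    rw [← inner_conj_symm, h1, Complex.conj_ofReal]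
  rw [← Complex.ofReal_inj]
  push_cast
  have := inner_self_eq_norm_sq_to_K (𝕜 := ℂ)
    (indicatorConstLp 2 (MeasurableSet.iUnion hΩ) (measure_ne_top μ _) (1 : ℂ) -
      ∑ n ∈ s, indicatorConstLp 2 (hΩ n) (measure_ne_top μ _) (1 : ℂ))
  refine this.symm.trans ?_
  simp only [inner_sub_left, inner_sub_right, sum_inner, inner_sum, h1, h2, h3, h4]
  simp +contextual

/-- The squared error of a partial sum is the measure not yet exhausted, which tends to zero by
countable additivity. Applying `S h` gives strong countable additivity of the projections. -/
theorem hasSum_indicatorConstLp (μ : Measure Circle) [IsFiniteMeasure μ]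
    {Ω : ℕ → Set Circle} (hΩ : ∀ n, MeasurableSet (Ω n))
    (hd : Pairwise (Function.onFun Disjoint Ω)) :
    HasSum (fun n => indicatorConstLp 2 (hΩ n) (measure_ne_top μ _) (1 : ℂ))
      (indicatorConstLp 2 (MeasurableSet.iUnion hΩ) (measure_ne_top μ _) (1 : ℂ)) := by
  have h1 : HasSum (fun n => μ.real (Ω n)) (μ.real (⋃ n, Ω n)) := by
    have h := measure_iUnion (μ := μ) hd hΩ
    rw [Measure.real, h, ENNReal.tsum_toReal_eq fun n => measure_ne_top μ _]
    exact (ENNReal.summable_toReal (h ▸ measure_ne_top μ _)).hasSum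
  rw [HasSum, tendsto_iff_norm_sub_tendsto_zero]
  have h2 := ((tendsto_const_nhds (x := μ.real (⋃ n, Ω n))).sub h1).sqrt
  rw [sub_self, Real.sqrt_zero] at h2
  refine h2.congr fun s => ?_
  rw [← norm_indicatorConstLp_sub_sum_sq μ hΩ hd s, Real.sqrt_sq (norm_nonneg _), norm_sub_rev]

theorem indicatorConstLp_univ_eq_toLp_one (μ : Measure Circle) [IsFiniteMeasure μ] :
    indicatorConstLp 2 MeasurableSet.univ (measure_ne_top μ _) (1 : ℂ) =
      ContinuousMap.toLp 2 μ ℂ (1 : C(Circle, ℂ)) := by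
  refine Lp.ext (indicatorConstLp_coeFn.trans ?_)
  rw [Set.indicator_univ]
  exact (ContinuousMap.coeFn_toLp μ 1).symm

/-- The projection attached to a Borel set by the functional calculus. -/
theorem exists_proj (Φ : C(Circle, ℂ) →⋆ₐ[ℂ] (H →L[ℂ] H)) (μ : H → Measure Circle)
    [∀ h, IsFiniteMeasure (μ h)] (S : ∀ h, Lp ℂ 2 (μ h) →ₗᵢ[ℂ] H)
    (hS : ∀ h f, S h (ContinuousMap.toLp 2 (μ h) ℂ f) = Φ f h)
    {Ω : Set Circle} (hΩ : MeasurableSet Ω) :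
    ∃ P : H →L[ℂ] H, ∀ h, P h = S h (indicatorConstLp 2 hΩ (measure_ne_top (μ h) Ω) 1) := by
  let F : H → H := fun h => S h (indicatorConstLp 2 hΩ (measure_ne_top (μ h) Ω) 1)
  -- `Φ g` is linear, so linearity of `F` follows once a single `g` approximates `F` at all the
  -- vectors in an identity. The sum of their measures dominates each one and supplies that common
  -- `g`.
  have happrox : ∀ a b c : H, ∀ ε > 0, ∃ g : C(Circle, ℂ),
      ‖F a - Φ g a‖ ≤ ε ∧ ‖F b - Φ g b‖ ≤ ε ∧ ‖F c - Φ g c‖ ≤ ε := by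
    intro a b c ε hε
    obtain ⟨g, hg⟩ := exists_continuousMap_norm_indicatorConstLp_sub_le (μ a + μ b + μ c) hΩ hε
    have key : ∀ h, μ h ≤ μ a + μ b + μ c → ‖F h - Φ g h‖ ≤ ε := by
      intro h hh
      rw [← hS, ← map_sub, LinearIsometry.norm_map]
      exact hg (μ h) hh
    refine ⟨g, key a ?_, key b ?_, key c ?_⟩
    · rw [add_assoc]; exact Measure.le_add_right le_rfl
    · exact Measure.le_add_right (Measure.le_add_left le_rfl)
    · exact Measure.le_add_left le_rfl
  have hadd : ∀ a b, F (a + b) = F a + F b := by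
    intro a b
    refine eq_of_forall_dist_le fun ε hε => ?_
    obtain ⟨g, h1, h2, h3⟩ := happrox a b (a + b) (ε / 3) (by positivity)
    have : F (a + b) - (F a + F b) =
        (F (a + b) - Φ g (a + b)) - (F a - Φ g a) - (F b - Φ g b) := by
      rw [map_add]; abel
    rw [dist_eq_norm, this]
    linarith [norm_sub_le (F (a + b) - Φ g (a + b) - (F a - Φ g a)) (F b - Φ g b),
      norm_sub_le (F (a + b) - Φ g (a + b)) (F a - Φ g a)]
  have hsmul : ∀ (c : ℂ) a, F (c • a) = c • F a := by
    intro c a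
    refine eq_of_forall_dist_le fun ε hε => ?_
    -- Only two vectors matter, so `0` fills the third slot. The two errors carry weights `1` and
    -- `‖c‖`, whence the divisor.
    obtain ⟨g, h1, h2, -⟩ := happrox a (c • a) 0 (ε / (1 + ‖c‖)) (by positivity)
    have : F (c • a) - c • F a = (F (c • a) - Φ g (c • a)) - c • (F a - Φ g a) := by
      rw [map_smul, smul_sub]; abel
    rw [dist_eq_norm, this]
    refine (norm_sub_le _ _).trans ?_
    rw [norm_smul]
    calc _ ≤ ε / (1 + ‖c‖) + ‖c‖ * (ε / (1 + ‖c‖)) := by gcongr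
      _ = ε := by field_simp
  have hbound : ∀ h, ‖F h‖ ≤ 1 * ‖h‖ := by
    intro h
    -- `S h` sends the constant `1` to `Φ 1 h = h`, so `‖h‖` is the norm of the indicator of the
    -- whole circle.
    have h1 : ‖h‖ = ‖indicatorConstLp 2 MeasurableSet.univ (measure_ne_top (μ h) _) (1 : ℂ)‖ := by
      rw [indicatorConstLp_univ_eq_toLp_one, ← LinearIsometry.norm_map (S h), hS,
        map_one Φ, one_apply_eq_self]
    rw [one_mul, h1, LinearIsometry.norm_map, norm_indicatorConstLp (by simp) (by simp),
      norm_indicatorConstLp (by simp) (by simp)]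
    gcongr
    · simp
    · exact Set.subset_univ _
  exact ⟨LinearMap.mkContinuous ⟨⟨F, hadd⟩, hsmul⟩ 1 hbound, fun h => rfl⟩

/-- The spectral theorem for unitary operators. -/
theorem exists_spectralMeasure_represents (U : H →L[ℂ] H) (hU : U ∈ unitary (H →L[ℂ] H)) :
    ∃ E : SpectralMeasure H, E.Represents U := by
  classical
  obtain ⟨Φ, hΦ⟩ := exists_starAlgHom_of_unitary U hU
  choose μ hfin hμ using exists_measure_inner_eq_integral Φ
  choose S hS using fun h => exists_linearIsometry_toLp Φ h (μ h) (hμ h)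
  choose P hP using fun (Ω : Set Circle) (hΩ : MeasurableSet Ω) => exists_proj Φ μ S hS hΩ
  have hinner : ∀ Ω₁ (h₁ : MeasurableSet Ω₁) Ω₂ (h₂ : MeasurableSet Ω₂) h,
      ⟪P Ω₁ h₁ h, P Ω₂ h₂ h⟫_ℂ = ((μ h).real (Ω₁ ∩ Ω₂) : ℂ) := by
    intro Ω₁ h₁ Ω₂ h₂ h
    rw [hP, hP, LinearIsometry.inner_map_map, L2.inner_indicatorConstLp_one_indicatorConstLp_one]
    rfl
  have huniv : P Set.univ MeasurableSet.univ = 1 := by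
    ext h
    rw [hP, indicatorConstLp_univ_eq_toLp_one, hS, map_one Φ]
  have hself : ∀ Ω (hΩ : MeasurableSet Ω) h, ⟪h, P Ω hΩ h⟫_ℂ = ((μ h).real Ω : ℂ) := by
    intro Ω hΩ h
    have := hinner Set.univ MeasurableSet.univ Ω hΩ h
    rwa [huniv, one_apply_eq_self, Set.univ_inter] at this
  have hstar : ∀ Ω₁ (h₁ : MeasurableSet Ω₁) Ω₂ (h₂ : MeasurableSet Ω₂),
      star (P Ω₁ h₁) * P Ω₂ h₂ = P (Ω₁ ∩ Ω₂) (h₁.inter h₂) := by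
    intro Ω₁ h₁ Ω₂ h₂
    -- Polarization over `ℂ`: equality of quadratic forms suffices, which is needed because each `μ
    -- h` belongs to a single vector. Taking `Ω₂` to be the circle then yields self-adjointness.
    refine ContinuousLinearMap.coe_injective ((ext_inner_map _ _).1 fun h => ?_)
    have h12 := (hinner Ω₁ h₁ Ω₂ h₂ h).trans (hself _ (h₁.inter h₂) h).symm
    rw [← ContinuousLinearMap.adjoint_inner_right, ← ContinuousLinearMap.star_eq_adjoint] at h12
    rw [← inner_conj_symm, ← inner_conj_symm _ h]
    exact congrArg _ h12
  have hsa : ∀ Ω (hΩ : MeasurableSet Ω), star (P Ω hΩ) = P Ω hΩ := by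
    intro Ω hΩ
    have := hstar Ω hΩ Set.univ MeasurableSet.univ
    simpa [huniv] using this
  have hmul : ∀ Ω₁ (h₁ : MeasurableSet Ω₁) Ω₂ (h₂ : MeasurableSet Ω₂),
      P Ω₁ h₁ * P Ω₂ h₂ = P (Ω₁ ∩ Ω₂) (h₁.inter h₂) := by
    intro Ω₁ h₁ Ω₂ h₂
    rw [← hstar, hsa]
  let E : SpectralMeasure H :=
    { proj := fun Ω => if hΩ : MeasurableSet Ω then P Ω hΩ else 0
      isStarProjection := fun Ω hΩ => by
        rw [dif_pos hΩ]
        exact ⟨by simpa [IsIdempotentElem] using hmul Ω hΩ Ω hΩ, hsa Ω hΩ⟩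
      empty := by
        rw [dif_pos MeasurableSet.empty]
        ext h
        rw [hP]
        simp
      univ := by rw [dif_pos MeasurableSet.univ, huniv]
      inter := fun Ω₁ Ω₂ h₁ h₂ => by
        rw [dif_pos h₁, dif_pos h₂, dif_pos (h₁.inter h₂), hmul]
      iUnion := fun Ω hΩ hd h => by
        simp only [dif_pos (hΩ _), dif_pos (MeasurableSet.iUnion hΩ), hP]
        exact (hasSum_indicatorConstLp (μ h) hΩ hd).mapL (S h).toContinuousLinearMap }
  refine ⟨E, fun h => ?_⟩
  -- Once the scalar measures are the `μ h`, representing `U` is the integral formula for the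
  -- coordinate function.
  have hE : E.scalarMeasure h = μ h := by
    ext Ω hΩ
    rw [SpectralMeasure.scalarMeasure, Measure.ofMeasurable_apply Ω hΩ]
    simp only [E, dif_pos hΩ, hself, Complex.ofReal_re]
    exact ofReal_measureReal
  rw [hE, ← hΦ, hμ]
  rfl

end SpectralTheorem

/-! ### Cyclic decompositions by maximality -/

namespace SpectralMeasure

variable {H : Type*} [NormedAddCommGroup H] [InnerProductSpace ℂ H] [CompleteSpace H]

theorem inner_proj_proj (E : SpectralMeasure H) {Ω₁ Ω₂ : Set Circle} (h₁ : MeasurableSet Ω₁)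
    (h₂ : MeasurableSet Ω₂) (a b : H) :
    ⟪E.proj Ω₁ a, E.proj Ω₂ b⟫_ℂ = ⟪a, E.proj (Ω₁ ∩ Ω₂) b⟫_ℂ := by
  rw [E.inter _ _ h₁ h₂, mul_apply_eq_comp,
    ← ContinuousLinearMap.adjoint_inner_left (E.proj Ω₁), ← ContinuousLinearMap.star_eq_adjoint,
    (E.isStarProjection _ h₁).isSelfAdjoint.star_eq]

theorem orbit_subset_cyclicSubspace (E : SpectralMeasure H) (v : H) :
    E.orbit v ⊆ E.cyclicSubspace v :=
  Submodule.subset_span.trans (Submodule.le_topologicalClosure _)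

/-- Since `⟪E(Ω₁) a, E(Ω₂) b⟫ = ⟪a, E(Ω₁ ∩ Ω₂) b⟫`, the hypothesis makes the orbits orthogonal; this
passes to closed spans one variable at a time. -/
theorem cyclicSubspace_isOrtho (E : SpectralMeasure H) {a b : H}
    (hab : ∀ Ω, MeasurableSet Ω → ⟪a, E.proj Ω b⟫_ℂ = 0) :
    E.cyclicSubspace a ⟂ E.cyclicSubspace b := by
  have key : ∀ (S : Set H) (K : Submodule ℂ H), (∀ s ∈ S, s ∈ Kᗮ) →
      (Submodule.span ℂ S).topologicalClosure ≤ Kᗮ := fun S K hS =>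
    Submodule.topologicalClosure_minimal _ (Submodule.span_le.2 hS) K.isClosed_orthogonal
  refine key _ _ ?_
  rintro _ ⟨Ω₁, h₁, rfl⟩
  rw [Submodule.mem_orthogonal']
  intro c hc
  have h2 : E.cyclicSubspace b ≤ (ℂ ∙ E.proj Ω₁ a)ᗮ := by
    refine key _ _ ?_
    rintro _ ⟨Ω₂, h₂, rfl⟩
    rw [Submodule.mem_orthogonal_singleton_iff_inner_right, E.inner_proj_proj h₁ h₂]
    exact hab _ (h₁.inter h₂)
  exact Submodule.mem_orthogonal_singleton_iff_inner_right.1 (h2 hc)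

/-- Every spectral measure on a separable Hilbert space has a countable cyclic decomposition. -/
theorem exists_isCyclicDecomposition [TopologicalSpace.SeparableSpace H] (E : SpectralMeasure H) :
    ∃ (ι : Type) (_ : Countable ι) (x : ι → H), E.IsCyclicDecomposition x := by
  let 𝒮 : Set (Set H) := {S | (∀ a ∈ S, ‖a‖ = 1) ∧ ∀ a ∈ S, ∀ b ∈ S, a ≠ b →
    ∀ Ω, MeasurableSet Ω → ⟪a, E.proj Ω b⟫_ℂ = 0}
  obtain ⟨S, hS⟩ : ∃ S, Maximal (· ∈ 𝒮) S := by
    refine zorn_subset 𝒮 fun c hc hchain => ⟨⋃₀ c, ⟨?_, ?_⟩, fun s hs =>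
      Set.subset_sUnion_of_mem hs⟩
    · rintro a ⟨s, hs, ha⟩
      exact (hc hs).1 a ha
    · rintro a ⟨s, hs, ha⟩ b ⟨t, ht, hb⟩ hab
      rcases hchain.total hs ht with hst | hst
      · exact (hc ht).2 a (hst ha) b hb hab
      · exact (hc hs).2 a ha b (hst hb) hab
  have hort : Orthonormal ℂ (fun a : S => (a : H)) := by
    refine ⟨fun a => hS.prop.1 a a.2, fun a b hab => ?_⟩
    have := hS.prop.2 a a.2 b b.2 (fun h => hab (Subtype.ext h)) _ MeasurableSet.univ
    rwa [E.univ] at this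
  have hcount : Countable S := by
    -- Orthonormal vectors are `√2 > 1` apart, so balls of radius `1/2` are disjoint.
    refine Pairwise.countable_of_isOpen_disjoint (s := fun a : S => Metric.ball (a : H) (1 / 2))
      (fun a b hab => Metric.ball_disjoint_ball ?_) (fun a => Metric.isOpen_ball)
      (fun a => Metric.nonempty_ball.2 (by norm_num))
    have h1 := norm_sub_sq (𝕜 := ℂ) (a : H) b
    rw [hort.2 hab, hort.1 a, hort.1 b] at h1
    rw [dist_eq_norm]
    norm_num at h1 ⊢
    nlinarith [norm_nonneg ((a : H) - b)]
  -- Reindexing by a subset of `ℕ` brings the index type down to `Type`, whatever the universe of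
  -- `H`.
  obtain ⟨e, he⟩ := hcount.exists_injective_nat
  let φ : Set.range e ≃ S := (Equiv.ofInjective e he).symm
  refine ⟨Set.range e, inferInstance, fun k => (φ k : H), hort.comp φ φ.injective, ?_⟩
  have hclosed : ∀ v, CompleteSpace (E.cyclicSubspace v) := fun v =>
    (Submodule.isClosed_topologicalClosure _).completeSpace_coe
  refine IsHilbertSum.mkInternal (fun k => E.cyclicSubspace (φ k : H)) ?_ ?_
  · refine OrthogonalFamily.of_pairwise fun j k hjk => E.cyclicSubspace_isOrtho ?_
    exact hS.prop.2 _ (φ j).2 _ (φ k).2 fun h => hjk (φ.injective (Subtype.ext h))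
  · rw [top_le_iff, Submodule.topologicalClosure_eq_top_iff, Submodule.eq_bot_iff]
    intro y hy
    by_contra hy0
    have hyS : ∀ a ∈ S, ∀ Ω, MeasurableSet Ω → ⟪y, E.proj Ω a⟫_ℂ = 0 := by
      intro a ha Ω hΩ
      refine (Submodule.mem_orthogonal' _ _).1 hy _ (Submodule.mem_iSup_of_mem (φ.symm ⟨a, ha⟩) ?_)
      rw [Equiv.apply_symm_apply]
      exact E.orbit_subset_cyclicSubspace a ⟨Ω, hΩ, rfl⟩
    let z : H := ((‖y‖⁻¹ : ℝ) : ℂ) • y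
    have hz : ‖z‖ = 1 := by
      simp [z, norm_smul, norm_ne_zero_iff.2 hy0]
    have hzS : ∀ a ∈ S, ∀ Ω, MeasurableSet Ω → ⟪z, E.proj Ω a⟫_ℂ = 0 := by
      intro a ha Ω hΩ
      rw [inner_smul_left, hyS a ha Ω hΩ, mul_zero]
    have hSz : ∀ a ∈ S, ∀ Ω, MeasurableSet Ω → ⟪a, E.proj Ω z⟫_ℂ = 0 := by
      intro a ha Ω hΩ
      have := E.inner_proj_proj hΩ MeasurableSet.univ a z
      rw [Set.inter_univ, E.univ, one_apply_eq_self] at this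
      rw [← this, ← inner_conj_symm, hzS a ha Ω hΩ, map_zero]
    have hins : insert z S ∈ 𝒮 := by
      refine ⟨?_, ?_⟩
      · rintro a (rfl | ha)
        · exact hz
        · exact hS.prop.1 a ha
      · rintro a (rfl | ha) b (rfl | hb) hab
        · exact absurd rfl hab
        · exact hzS b hb
        · exact hSz a ha
        · exact hS.prop.2 a ha b hb hab
    -- Maximality forces `z ∈ S`, and then orthogonality to `S` makes the unit vector `z` orthogonal
    -- to itself.
    have hzmem : z ∈ S := hS.le_of_ge hins (Set.subset_insert z S) (Set.mem_insert z S)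
    have := hzS z hzmem _ MeasurableSet.univ
    rw [E.univ, one_apply_eq_self, inner_self_eq_zero] at this
    rw [this, norm_zero] at hz
    exact zero_ne_one hz

/-! ### Complexification of `H_ℝ` and the block matrix -/

variable {E : SpectralMeasure H} {ι : Type*} {x : ι → H}

/-- The unitary `(a, b) ↦ a + i b` of the complexification of `H_ℝ` onto `H`. -/
noncomputable def complexificationEquiv (hx : E.IsCyclicDecomposition x) :
    Complexification (E.realSubspace x) ≃ₗᵢ[ℂ] H :=
  LinearIsometryEquiv.ofSurjective
    { toFun := fun z => (z.fst : H) + Complex.I • (z.snd : H)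
      map_add' := fun z w => by
        simp only [Complexification.fst_add, Complexification.snd_add, Submodule.coe_add]
        module
      map_smul' := fun c z => by
        simp only [Complexification.fst_smul, Complexification.snd_smul, Submodule.coe_add,
          Submodule.coe_sub, Submodule.coe_smul, RingHom.id_apply, ← Complex.coe_smul]
        conv_rhs => rw [← Complex.re_add_im c]
        (match_scalars <;> ring_nf); simp
      norm_map' := fun z => (sq_eq_sq₀ (norm_nonneg _) (norm_nonneg _)).1 <| by
        rw [Complexification.norm_sq]
        exact norm_add_I_smul hx z.fst.2 z.snd.2 }
    (fun h => by
      have hh : h ∈ E.realSubspace x ⊔ E.imagSubspace x := by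
        rw [(isCompl_real_imag hx).sup_eq_top]; trivial
      obtain ⟨a, ha, b, hb, rfl⟩ := Submodule.mem_sup.1 hh
      obtain ⟨c, hc, rfl⟩ := mem_imagSubspace.1 hb
      exact ⟨Complexification.mk ⟨a, ha⟩ ⟨c, hc⟩, rfl⟩)

theorem complexificationEquiv_apply (hx : E.IsCyclicDecomposition x)
    (z : Complexification (E.realSubspace x)) :
    complexificationEquiv hx z = (z.fst : H) + Complex.I • (z.snd : H) := rfl

/-- If `U a = p + i q` with `p`, `q` in `H_ℝ`, then `i U a = -q + i p`. Hence `-Q_ℝ (i U a) = q`,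
which explains the sign in `U_c`. -/
theorem realComponent_add_I_smul_imagComponent (hx : E.IsCyclicDecomposition x) (U : H →L[ℂ] H)
    (a : E.realSubspace x) :
    (realComponent hx U a : H) + Complex.I • (imagComponent hx U a : H) = U a := by
  obtain ⟨z, hz⟩ := (complexificationEquiv hx).surjective (U a)
  rw [complexificationEquiv_apply] at hz
  have hr : realComponent hx U a = z.fst := by
    change realPart hx (U a) = _
    rw [← hz, realPart_add_I_smul]
  have hc : imagComponent hx U a = z.snd := by
    change -realPart hx (Complex.I • U a) = _
    have : Complex.I • U a = ((-z.snd : E.realSubspace x) : H) + Complex.I • (z.fst : H) := by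
      rw [← hz, smul_add, smul_smul, Complex.I_mul_I, Submodule.coe_neg]
      module
    rw [this, realPart_add_I_smul, neg_neg]
  rw [hr, hc, hz]

/-- Expand `U (a + i b) = U a + i U b` by the previous decomposition; `i² = -1` produces the entry
`-U_c`. -/
theorem unitarilyEquivalent_blockOp (hx : E.IsCyclicDecomposition x) (U : H →L[ℂ] H) :
    UnitarilyEquivalent U (Complexification.blockOp (realComponent hx U) (imagComponent hx U)) := by
  refine ⟨(complexificationEquiv hx).symm, fun h => ?_⟩
  obtain ⟨z, rfl⟩ := (complexificationEquiv hx).surjective h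
  rw [LinearIsometryEquiv.symm_apply_apply, LinearIsometryEquiv.symm_apply_eq,
    complexificationEquiv_apply, complexificationEquiv_apply, map_add, map_smul,
    ← realComponent_add_I_smul_imagComponent hx U z.fst,
    ← realComponent_add_I_smul_imagComponent hx U z.snd]
  simp only [Complexification.blockOp, ContinuousLinearMap.coe_mk', LinearMap.coe_mk,
    AddHom.coe_mk, Complexification.fst_mk, Complexification.snd_mk, Submodule.coe_sub,
    Submodule.coe_add, smul_add, smul_smul, Complex.I_mul_I]
  module

end SpectralMeasure

theorem mainTheorem6 {H : Type*} [NormedAddCommGroup H] [InnerProductSpace ℂ H] [CompleteSpace H]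
    [TopologicalSpace.SeparableSpace H] (U : H →L[ℂ] H) (hU : U ∈ unitary (H →L[ℂ] H)) :
    (∃ E : SpectralMeasure H, E.Represents U) ∧
    ∀ E : SpectralMeasure H, E.Represents U →
      (∃ (ι : Type) (_ : Countable ι) (x : ι → H), E.IsCyclicDecomposition x) ∧
      ∀ (ι : Type) (_ : Countable ι) (x : ι → H) (hx : E.IsCyclicDecomposition x),
        UnitarilyEquivalent U
          (Complexification.blockOp (SpectralMeasure.realComponent hx U)
            (SpectralMeasure.imagComponent hx U)) :=
  ⟨exists_spectralMeasure_represents U hU, fun E _ =>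
    ⟨E.exists_isCyclicDecomposition, fun _ _ _ hx =>
      SpectralMeasure.unitarilyEquivalent_blockOp hx U⟩⟩
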